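/- Let $\Bbbk$ be an algebraically closed field, $G$ a linear algebraic group over $\Bbbk$, and $H=\Bbbk[G]$ its coordinate Hopf algebra (a finitely generated reduced commutative Hopf algebra whose $\Bbbk$-points form $G$), with coproduct $\Delta(h)=h_{(1)}\otimes h_{(2)}$ and antipode $S$. For $g\in G$ let $L_g h=h_{(1)}(g)h_{(2)}$, i.e. $(L_gh)(x)=h(gx)$. Let $M_n=H^n$ be the free $H$-module of rank $n$. Let $\mathrm{Cend}_n=\mathrm{Cend}^{G,G}_n$ be the space of all maps $a:G\to \mathrm{End}_{\Bbbk} M_n$ such that $g\mapsto a(g)u$ is a regular $M_n$-valued function on $G$ for each $u\in M_n$, and $a(g)(fu)=(L_gf)\,a(g)u$ for all $g\in G$, $f\in H$, $u\in M_n$. It is an $H$-module by $(fa)(g)=f(g^{-1})a(g)$ and carries the operations $(a\circ_g b)(z)=a(g)\,b(zg^{-1})$, $g\in G$. A conformal subalgebra of $\mathrm{Cend}_n$ is an $H$-submodule closed under all operations $\circ_g$; a left ideal is an $H$-submodule $B$ with $a\circ_g b\in B$ for all $a\in \mathrm{Cend}_n$, $b\in B$, $g\in G$. The space $H\otimes H\otimes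 \mathbb M_n(\Bbbk)\simeq H\otimes\mathbb M_n(H)$ is identified with $\mathrm{Cend}_n$ by letting $h\otimes f\otimes A$ be the map $g\mapsto h(g^{-1})\,fL_g\otimes A$. Let $\mathcal F$ be the linear transformation of this space given by $\mathcal F(f\otimes a\otimes A)=fS(a_{(1)})\otimes a_{(2)}\otimes A$. A conformal subalgebra $C$ is irreducible if the only $H$-submodules of $M_n$ invariant under all operators $a(g)$, $a\in C$, $g\in G$, are $\{0\}$ and $M_n$. A left ideal of a ring is essential if it has nonzero intersection with every nonzero left ideal. **Theorem.** Let $C\neq 0$ be an irreducible conformal subalgebra of $\mathrm{Cend}_n$. Let $C_1=(1\otimes H\otimes E)C$, i.e. the linear span of all maps $g\mapsto h\,c(g)$ with $h\in H$, $c\in C$. Then $C_1$ is a left ideal of $\mathrm{Cend}_n$, and $C_1=\mathcal F(H\otimes B_0)$ for some essential left ideal $B_0$ of $\mathbb M_n(H)$. In particular, if $G=\{e\}$ (so that $\mathrm{Cend}_n=\mathbb M_n(\Bbbk)$), then $C=\mathrm{Cend}_n$, which is Burnside's theorem. -/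

import Mathlib

open scoped TensorProduct

noncomputable section

namespace GConf

section

variable (k H : Type*) [Field k] [CommRing H] [HopfAlgebra k H]

/-- The group `G` of `k`-points of the commutative Hopf algebra `H`. Over an algebraically closed
field, when `H` is finitely generated and reduced, this is the linear algebraic group with
coordinate algebra `H`, and `h ∈ H` is the regular function `g ↦ g h` on it. The group law is the
convolution product: `(g₁ * g₂) h = ∑ g₁ h₍₁₎ * g₂ h₍₂₎`, `1 = ε`, `g⁻¹ = g ∘ S`. -/
abbrev Pt : Type _ := WithConv (H →ₐ[k] k)

end

variable {k H : Type*} [Field k] [CommRing H] [HopfAlgebra k H]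

/-- The value at the point `g` of an `M`-valued regular function on `G`, that is, of an element
of `H ⊗ M`: `h ⊗ v ↦ h(g) v`. -/
def evalAt {M : Type*} [AddCommGroup M] [Module k M] (g : Pt k H) : H ⊗[k] M →ₗ[k] M :=
  (TensorProduct.lid k M).toLinearMap ∘ₗ LinearMap.rTensor M g.ofConv.toLinearMap

/-- A map `a : G → End M` is locally regular if `g ↦ a(g) u` is a regular `M`-valued function
for every `u ∈ M`. -/
def LocallyRegular {M : Type*} [AddCommGroup M] [Module k M]
    (a : Pt k H → Module.End k M) : Prop :=
  ∀ u : M, ∃ t : H ⊗[k] M, ∀ g : Pt k H, a g u = evalAt g t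

/-- The left shift `L_g h = h₍₁₎(g) h₍₂₎`, i.e. `(L_g h)(x) = h(g x)`. -/
def leftShift (g : Pt k H) : H →ₗ[k] H :=
  evalAt g ∘ₗ Coalgebra.comul

variable {n : ℕ}

variable (k H n) in
/-- Maps from `G` to the `k`-linear endomorphisms of the free `H`-module `M_n = H^n`. -/
abbrev EndMap : Type _ := Pt k H → Module.End k (Fin n → H)

variable (k H n) in
/-- `Cend_n`: the space of conformal endomorphisms of `M_n = H^n`, i.e. of the locally regular maps
`a : G → End M_n` that are translation invariant, `a(g)(f u) = (L_g f) (a(g) u)`. -/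
def Cend : Submodule k (EndMap k H n) where
  carrier := {a | LocallyRegular a ∧
    ∀ (g : Pt k H) (f : H) (u : Fin n → H), a g (f • u) = leftShift g f • a g u}
  add_mem' := by
    rintro a b ⟨ha, ha'⟩ ⟨hb, hb'⟩
    refine ⟨fun u => ?_, fun g f u => ?_⟩
    · obtain ⟨s, hs⟩ := ha u
      obtain ⟨t, ht⟩ := hb u
      exact ⟨s + t, fun g => by simp [hs, ht]⟩
    · simp [ha', hb']
  zero_mem' := ⟨fun _ => ⟨0, fun g => by simp⟩, fun g f u => by simp⟩
  smul_mem' := by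
    rintro c a ⟨ha, ha'⟩
    refine ⟨fun u => ?_, fun g f u => ?_⟩
    · obtain ⟨s, hs⟩ := ha u
      exact ⟨c • s, fun g => by simp [hs]⟩
    · simp only [Pi.smul_apply, LinearMap.smul_apply, ha']
      exact smul_comm _ _ _

/-- The `H`-module structure of `Cend_n`: `(f a)(g) = f(g⁻¹) a(g)`. -/
def hAct (f : H) (a : EndMap k H n) : EndMap k H n :=
  fun g => g⁻¹ f • a g

/-- The conformal products: `(a ∘_g b)(z) = a(g) b(z g⁻¹)`. -/
def cProd (g : Pt k H) (a b : EndMap k H n) : EndMap k H n :=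
  fun z => a g * b (z * g⁻¹)

/-- Conformal subalgebras of `Cend_n`: the `H`-submodules closed under all products `∘_g`. -/
structure IsConformalSubalgebra (C : Submodule k (EndMap k H n)) : Prop where
  le_cend : C ≤ Cend k H n
  hAct_mem : ∀ (f : H), ∀ a ∈ C, hAct f a ∈ C
  cProd_mem : ∀ (g : Pt k H), ∀ a ∈ C, ∀ b ∈ C, cProd g a b ∈ C

/-- Left ideals of the conformal algebra `Cend_n`. -/
structure IsLeftIdeal (B : Submodule k (EndMap k H n)) : Prop where
  le_cend : B ≤ Cend k H n
  hAct_mem : ∀ (f : H), ∀ b ∈ B, hAct f b ∈ B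
  cProd_mem : ∀ (g : Pt k H), ∀ a ∈ Cend k H n, ∀ b ∈ B, cProd g a b ∈ B

/-- `W_n(C)`: the linear span of all operators `a(g)`, `a ∈ C`, `g ∈ G`. -/
def operators (C : Submodule k (EndMap k H n)) : Submodule k (Module.End k (Fin n → H)) :=
  Submodule.span k {α | ∃ a ∈ C, ∃ g : Pt k H, α = a g}

/-- `M_n` has no `W_n(C)`-invariant `H`-submodules except `0` and `M_n`. -/
def IsIrreducible (C : Submodule k (EndMap k H n)) : Prop :=
  ∀ N : Submodule H (Fin n → H),
    (∀ α ∈ operators C, ∀ u ∈ N, α u ∈ N) → N = ⊥ ∨ N = ⊤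

/-- The operator which the element `T` of `H ⊗ H ⊗ M_n(k) = M_n(H ⊗ H)` defines at `g ∈ G`:
`h ⊗ f ⊗ A` goes to `h(g⁻¹) f L_g ⊗ A`. -/
def operatorAt (g : Pt k H) : Matrix (Fin n) (Fin n) (H ⊗[k] H) →ₗ[k]
    Module.End k (Fin n → H) where
  toFun T :=
    { toFun := fun u i => ∑ j, evalAt g⁻¹ (T i j) * leftShift g (u j)
      map_add' := fun u v => by
        ext i
        simp [mul_add, Finset.sum_add_distrib]
      map_smul' := fun c u => by
        ext i
        simp [Finset.smul_sum] }
  map_add' S T := by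
    ext u i
    simp [add_mul, Finset.sum_add_distrib]
  map_smul' c T := by
    ext u i
    simp only [Matrix.smul_apply, map_smul, smul_mul_assoc, LinearMap.comp_apply, LinearMap.coe_mk,
      AddHom.coe_mk, RingHom.id_apply, LinearMap.smul_apply, Pi.smul_apply, Finset.smul_sum]

/-- The identification of `H ⊗ H ⊗ M_n(k) = M_n(H ⊗ H)` with `Cend_n`. -/
def ofTensor : Matrix (Fin n) (Fin n) (H ⊗[k] H) →ₗ[k] EndMap k H n :=
  LinearMap.pi operatorAt

/-- The set of products `(1 ⊗ h ⊗ E) c`, `h ∈ H`, `c ∈ C`, spans `C_1 = (1 ⊗ H ⊗ E) C`. Here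
`(1 ⊗ h ⊗ E) c` is the map `g ↦ h c(g)`; see `ofTensor_scalar_mul`. -/
def adjoinH (C : Submodule k (EndMap k H n)) : Submodule k (EndMap k H n) :=
  Submodule.span k {x | ∃ h : H, ∃ c ∈ C, x = fun g => Algebra.lsmul k k (Fin n → H) h * c g}

theorem ofTensor_scalar_mul (h : H) (T : Matrix (Fin n) (Fin n) (H ⊗[k] H)) :
    ofTensor (Matrix.scalar (Fin n) (1 ⊗ₜ[k] h) * T) =
      fun g => Algebra.lsmul k k (Fin n → H) h * ofTensor T g := by
  have key : ∀ (g : Pt k H) (t : H ⊗[k] H), evalAt g ((1 ⊗ₜ[k] h) * t) = h * evalAt g t := by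
    intro g t
    induction t with
    | zero => simp
    | add x y hx hy => simp [mul_add, hx, hy]
    | tmul x y => simp [evalAt]
  funext g
  ext u i
  simp [ofTensor, operatorAt, Matrix.scalar_apply, Matrix.diagonal_mul, key, Finset.mul_sum,
    mul_assoc]

/-- The `H`-linear map `F : H ⊗ H → H ⊗ H`, `F(f ⊗ a) = f S(a₍₁₎) ⊗ a₍₂₎`. -/
def fourier : H ⊗[k] H →ₐ[k] H ⊗[k] H :=
  Algebra.TensorProduct.lift Algebra.TensorProduct.includeLeft
    ((Algebra.TensorProduct.map (HopfAlgebra.antipodeAlgHom k H) (AlgHom.id k H)).comp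
      (Bialgebra.comulAlgHom k H))
    (fun _ _ => Commute.all _ _)

/-- The subspace `H ⊗ B₀` of `H ⊗ M_n(H) = M_n(H ⊗ H)`. -/
def tensorIdeal (B₀ : Ideal (Matrix (Fin n) (Fin n) H)) :
    Submodule k (Matrix (Fin n) (Fin n) (H ⊗[k] H)) :=
  Submodule.span k {T | ∃ h : H, ∃ b ∈ B₀, T = b.map fun x => h ⊗ₜ[k] x}

/-- The subspace `F(H ⊗ B₀)` of `Cend_n`, where `F` is applied entrywise. -/
def fourierIdeal (B₀ : Ideal (Matrix (Fin n) (Fin n) H)) : Submodule k (EndMap k H n) :=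
  ((tensorIdeal (k := k) B₀).map (fourier (k := k) (H := H)).toLinearMap.mapMatrix).map ofTensor

/-- A left ideal is essential if it meets every nonzero left ideal nontrivially. -/
def IsEssential {R : Type*} [Ring R] (B : Ideal R) : Prop :=
  ∀ I : Ideal R, I ≠ ⊥ → B ⊓ I ≠ ⊥

end GConf

end

/-!
Let `M = H^n`. A column `u` and a row `v` define the element `z ↦ (p ↦ L_z(v · p) u)` of `Cend_n`,
which identifies `Cend_n` with `M ⊗ M`; here the values `a(g)` of elements of `Cend_n` act on the
first factor by means of the products `a ∘_g -`. So `C_1` becomes a subspace of `M ⊗ M` stable under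
the operators `α ⊗ 1` with `α` in an algebra that contains `H` and acts irreducibly on `M`. The
endomorphisms of `M` commuting with this algebra form a division ring of `H`-linear maps, which the
counit embeds into the matrices over `k`; as `k` is algebraically closed, they are scalars. By the
density theorem `C_1` is then stable under all of `End M ⊗ 1`, that is, `C_1 = M ⊗ V`; the action of
`H` on `Cend_n` makes `V` an `H`-submodule, and `M ⊗ V` is `F(H ⊗ B₀)` for the left ideal `B₀` of
matrices with rows in `V`.

A column orthogonal to `V` is killed by `C`, hence is zero by irreducibility, so `M / V` has zero
dual. At a minimal prime of the reduced ring `H` the localization is a field, over which a finite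
module with zero dual vanishes. So every row has a nonzero multiple in `V`, and `B₀` is essential.
-/

noncomputable section

namespace GConf

section CommutativeAlgebra

theorem exists_notMem_minimalPrimes {R : Type*} [CommRing R] [IsReduced R] {x : R} (hx : x ≠ 0) :
    ∃ P ∈ minimalPrimes R, x ∉ P := by
  by_contra! hmem
  have hx' : x ∈ sInf (⊥ : Ideal R).minimalPrimes := Ideal.mem_sInf.mpr fun {P} => hmem P
  rw [Ideal.sInf_minimalPrimes, Ideal.radical_bot_of_isReduced] at hx'
  exact hx hx'

theorem subsingleton_localizedModule_of_subsingleton_dual {R M : Type*} [CommRing R] [IsReduced R]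
    [AddCommGroup M] [Module R M] [Module.FinitePresentation R M]
    [Subsingleton (Module.Dual R M)] {P : Ideal R} [P.IsPrime] (hP : P ∈ minimalPrimes R) :
    Subsingleton (LocalizedModule P.primeCompl M) := by
  let K := Localization.AtPrime P
  have : Ring.KrullDimLE 0 K := .of_isLocalization P hP K
  let : Field K := Ring.KrullDimLE.isField_of_isReduced.toField
  have : Subsingleton (Module.Dual K (LocalizedModule P.primeCompl M)) := by
    have := Module.FinitePresentation.isLocalizedModule_mapExtendScalars P.primeCompl
      (LocalizedModule.mkLinearMap P.primeCompl M) (Algebra.linearMap R K) K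
    exact IsLocalizedModule.subsingleton_of_subsingleton P.primeCompl
      (IsLocalizedModule.mapExtendScalars P.primeCompl
        (LocalizedModule.mkLinearMap P.primeCompl M) (Algebra.linearMap R K) K)
  refine subsingleton_of_forall_eq 0 fun x => ?_
  exact (Module.forall_dual_apply_eq_zero_iff K x).mp fun f => by rw [Subsingleton.elim f 0]; rfl

theorem exists_smul_mem_of_forall_dotProduct_eq_zero {R ι : Type*} [CommRing R] [IsReduced R]
    [Fintype ι] {V : Submodule R (ι → R)} (hfg : V.FG)
    (hV : ∀ p : ι → R, (∀ v ∈ V, v ⬝ᵥ p = 0) → p = 0) {v : ι → R} (hv : v ≠ 0) :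
    ∃ r : R, r • v ∈ V ∧ r • v ≠ 0 := by
  classical
  have : Module.FinitePresentation R ((ι → R) ⧸ V) :=
    Module.finitePresentation_of_surjective V.mkQ V.mkQ_surjective (by rwa [V.ker_mkQ])
  have : Subsingleton (Module.Dual R ((ι → R) ⧸ V)) := by
    refine subsingleton_of_forall_eq 0 fun f => ?_
    have hp : (dotProductEquiv R ι).symm (f ∘ₗ V.mkQ) = 0 := hV _ fun v hv => by
      rw [dotProduct_comm, ← dotProductEquiv_apply_apply, LinearEquiv.apply_symm_apply,
        LinearMap.comp_apply, V.mkQ_apply, (Submodule.Quotient.mk_eq_zero V).mpr hv, map_zero]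
    exact LinearMap.cancel_right V.mkQ_surjective |>.mp
      (by simpa using hp)
  obtain ⟨i, hi⟩ := Function.ne_iff.mp hv
  obtain ⟨P, hP, hviP⟩ := exists_notMem_minimalPrimes hi
  have hprime : P.IsPrime := hP.1.1
  have := subsingleton_localizedModule_of_subsingleton_dual (M := (ι → R) ⧸ V) hP
  obtain ⟨r, hrP, hr⟩ := LocalizedModule.subsingleton_iff.mp this (V.mkQ v)
  refine ⟨r, ?_, fun h0 => ?_⟩
  · rwa [← map_smul, Submodule.mkQ_apply, Submodule.Quotient.mk_eq_zero] at hr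
  · have hri : r * v i = 0 := congrFun h0 i
    exact hprime.mul_notMem hrP hviP (hri ▸ P.zero_mem)

theorem eq_zero_of_forall_algHom_apply_eq_zero {k H : Type*} [Field k] [IsAlgClosed k] [CommRing H]
    [Algebra k H] [Algebra.FiniteType k H] [IsReduced H] {h : H}
    (hh : ∀ g : H →ₐ[k] k, g h = 0) : h = 0 := by
  have : IsJacobsonRing H := isJacobsonRing_of_finiteType (A := k)
  have hmem : h ∈ (⊥ : Ideal H).jacobson := by
    refine Ideal.mem_sInf.mpr fun {m} ⟨_, hm⟩ => ?_
    let := Ideal.Quotient.field m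
    have : Module.Finite k (H ⧸ m) := finite_of_finite_type_of_isJacobsonRing k (H ⧸ m)
    let e : k ≃ₐ[k] H ⧸ m := AlgEquiv.ofBijective (Algebra.ofId k (H ⧸ m))
      IsAlgClosed.algebraMap_bijective_of_isIntegral
    have := hh (e.symm.toAlgHom.comp (Ideal.Quotient.mkₐ k m))
    exact Ideal.Quotient.eq_zero_iff_mem.mp (by simpa using this)
  rwa [← Ideal.radical_eq_jacobson, Ideal.radical_bot_of_isReduced] at hmem

end CommutativeAlgebra

section Density

variable {k A M : Type*} [Ring A] [AddCommGroup M] [Module A M]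

theorem algebraMap_end_bijective_of_forall_exists_smul_eq {H : Type*} [Field k] [IsAlgClosed k]
    [Algebra k A] [Module k M] [IsScalarTower k A M] [IsSimpleModule A M] [CommRing H] [Algebra k H]
    [Module H M] [IsScalarTower k H M] [Module.Free H M] [Module.Finite H M] (ε : H →ₐ[k] k)
    (hH : ∀ h : H, ∃ a : A, ∀ u : M, a • u = h • u) :
    Function.Bijective (algebraMap k (Module.End A M)) := by
  classical
  have : Nontrivial H := ε.toRingHom.domain_nontrivial
  have : Nontrivial M := IsSimpleModule.nontrivial A M
  let b := Module.Free.chooseBasis H M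
  let toEnd : Module.End A M →ₐ[k] Module.End H M :=
    { toFun φ :=
        { φ with
          map_smul' h u := by
            obtain ⟨a, ha⟩ := hH h
            simp [← ha] }
      map_one' := rfl
      map_mul' _ _ := rfl
      map_zero' := rfl
      map_add' _ _ := rfl
      commutes' _ := rfl }
  let toMatrix : Module.End A M →ₐ[k] Matrix _ _ k :=
    (ε.mapMatrix.comp ((LinearMap.toMatrixAlgEquiv b).toAlgHom.restrictScalars k)).comp toEnd
  have : Module.Finite k (Module.End A M) :=
    Module.Finite.of_injective toMatrix.toLinearMap toMatrix.toRingHom.injective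
  exact IsAlgClosed.algebraMap_bijective_of_isIntegral

theorem exists_forall_apply_eq_smul [CommRing k] [Algebra k A] [Module k M] [IsScalarTower k A M]
    [IsSemisimpleModule A M] (hA : Function.Surjective (algebraMap k (Module.End A M)))
    (α : Module.End k M) (s : Finset M) : ∃ a : A, ∀ u ∈ s, α u = a • u := by
  let F : Module.End (Module.End A M) M :=
    { α with
      map_smul' φ u := by
        obtain ⟨c, rfl⟩ := hA φ
        simp }
  exact jacobson_density F s

end Density

section Tensor

variable {k M N : Type*} [CommSemiring k] [AddCommMonoid M] [Module k M] [AddCommMonoid N]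
  [Module k N]

/-- The endomorphisms `α` of `M` whose action `α ⊗ id` on `M ⊗ N` preserves a subspace `T`. -/
def leftStabilizer (T : Submodule k (M ⊗[k] N)) : Subalgebra k (Module.End k M) where
  carrier := {α | ∀ t ∈ T, α.rTensor N t ∈ T}
  mul_mem' {α β} hα hβ t ht := by
    rw [LinearMap.rTensor_mul]
    exact hα _ (hβ t ht)
  add_mem' {α β} hα hβ t ht := by
    rw [LinearMap.rTensor_add]
    exact T.add_mem (hα t ht) (hβ t ht)
  algebraMap_mem' c t ht := by
    rw [Algebra.algebraMap_eq_smul_one, LinearMap.rTensor_smul, Module.End.one_eq_id,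
      LinearMap.rTensor_id]
    exact T.smul_mem c ht

theorem mem_leftStabilizer {T : Submodule k (M ⊗[k] N)} {α : Module.End k M} :
    α ∈ leftStabilizer T ↔ ∀ t ∈ T, α.rTensor N t ∈ T := Iff.rfl

/-- The largest subspace `V` of `N` such that `M ⊗ V` is contained in a given subspace `T` of
`M ⊗ N`. -/
def rightFactor (T : Submodule k (M ⊗[k] N)) : Submodule k N :=
  ⨅ u : M, T.comap (TensorProduct.mk k M N u)

theorem mem_rightFactor {T : Submodule k (M ⊗[k] N)} {v : N} :
    v ∈ rightFactor T ↔ ∀ u : M, u ⊗ₜ v ∈ T := by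
  simp [rightFactor]

theorem leftStabilizer_eq_top {T : Submodule k (M ⊗[k] N)}
    (h : ∀ (α : Module.End k M) (s : Finset M), ∃ β ∈ leftStabilizer T, ∀ u ∈ s, α u = β u) :
    leftStabilizer T = ⊤ := by
  classical
  refine eq_top_iff.mpr fun α _ t ht => ?_
  obtain ⟨s, hs⟩ := TensorProduct.exists_finset t
  obtain ⟨β, hβ, hαβ⟩ := h α (s.image Prod.fst)
  have : α.rTensor N t = β.rTensor N t := by
    rw [hs, map_sum, map_sum]
    refine Finset.sum_congr rfl fun i hi => ?_
    rw [LinearMap.rTensor_tmul, LinearMap.rTensor_tmul, hαβ _ (Finset.mem_image_of_mem _ hi)]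
  exact this ▸ hβ t ht

theorem map₂_mk_rightFactor [Module.Free k M] {T : Submodule k (M ⊗[k] N)}
    (hT : leftStabilizer T = ⊤) :
    Submodule.map₂ (TensorProduct.mk k M N) ⊤ (rightFactor T) = T := by
  classical
  refine le_antisymm (Submodule.map₂_le.mpr fun u _ v hv => mem_rightFactor.mp hv u) fun t ht => ?_
  let b := Module.Free.chooseBasis k M
  have rTensor_coord (i) (u : M) :
      ((b.coord i).smulRight u).rTensor N t = u ⊗ₜ TensorProduct.equivFinsuppOfBasisLeft b t i := by
    clear ht
    induction t with
    | zero => simp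
    | add x y hx hy => simp [hx, hy, TensorProduct.tmul_add]
    | tmul m n => simp [TensorProduct.smul_tmul]
  rw [← (TensorProduct.equivFinsuppOfBasisLeft b).symm_apply_apply t,
    TensorProduct.equivFinsuppOfBasisLeft_symm_apply]
  refine sum_mem fun i _ => Submodule.apply_mem_map₂ _ trivial (mem_rightFactor.mpr fun u => ?_)
  rw [← rTensor_coord]
  exact mem_leftStabilizer.mp (hT ▸ Algebra.mem_top) t ht

end Tensor

section Shift

open WithConv Coalgebra

variable {k H : Type*} [Field k] [CommRing H] [HopfAlgebra k H] {h : H} {ι : Type*}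

theorem convMul_apply_eq_sum {A : Type*} [CommRing A] [Algebra k A]
    (f g : WithConv (H →ₐ[k] A)) (r : Repr k h ι) :
    (f * g) h = ∑ i ∈ r.index, f (r.left i) * g (r.right i) := by
  simp [AlgHom.convMul_apply, ← r.eq]

theorem inv_apply (g : Pt k H) (h : H) : g⁻¹ h = g (HopfAlgebra.antipode k h) := rfl

theorem inv_apply_antipode (g : Pt k H) (h : H) : g⁻¹ (HopfAlgebra.antipode k h) = g h :=
  congrArg (fun f : Pt k H => f h) (inv_inv g)

theorem evalAt_tmul {M : Type*} [AddCommGroup M] [Module k M] (g : Pt k H) (h : H) (v : M) :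
    evalAt g (h ⊗ₜ[k] v) = g h • v := by
  simp [evalAt]

theorem evalAt_lTensor {M N : Type*} [AddCommGroup M] [Module k M] [AddCommGroup N] [Module k N]
    (g : Pt k H) (f : M →ₗ[k] N) (t : H ⊗[k] M) :
    evalAt g (f.lTensor H t) = f (evalAt g t) := by
  induction t with
  | zero => simp
  | add x y hx hy => simp [hx, hy]
  | tmul x y => simp [evalAt_tmul]

theorem leftShift_eq_sum (g : Pt k H) (r : Repr k h ι) :
    leftShift g h = ∑ i ∈ r.index, g (r.left i) • r.right i := by
  simp [leftShift, ← r.eq, evalAt_tmul]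

/-- The point `g` of `G` seen as an `H`-valued point of the affine group scheme `Spec H`. -/
def constPt (g : Pt k H) : WithConv (H →ₐ[k] H) :=
  toConv ((Algebra.ofId k H).comp g.ofConv)

theorem constPt_mul (g g' : Pt k H) : constPt (g * g') = constPt g * constPt g' :=
  ofConv_injective (AlgHom.comp_convMul_distrib (Algebra.ofId k H) g g')

/-- The left shift as an algebra homomorphism: the convolution product of a constant point with the
generic point `id` of `Spec H`. -/
def leftShiftAlgHom (g : Pt k H) : H →ₐ[k] H :=
  (constPt g * toConv (AlgHom.id k H)).ofConv

theorem leftShiftAlgHom_apply (g : Pt k H) (h : H) : leftShiftAlgHom g h = leftShift g h := by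
  rw [leftShift_eq_sum g (ℛ k h)]
  refine (convMul_apply_eq_sum _ _ (ℛ k h)).trans ?_
  simp [constPt, Algebra.ofId_apply, Algebra.smul_def]

theorem leftShift_mul (g : Pt k H) (a b : H) :
    leftShift g (a * b) = leftShift g a * leftShift g b := by
  simp only [← leftShiftAlgHom_apply, map_mul]

theorem leftShift_one (h : H) : leftShift (1 : Pt k H) h = h := by
  rw [leftShift_eq_sum _ (ℛ k h)]
  simpa using sum_counit_smul (ℛ k h)

theorem leftShift_leftShift (g g' : Pt k H) (h : H) :
    leftShift g (leftShift g' h) = leftShift (g' * g) h := by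
  have comp_constPt : (leftShiftAlgHom g).comp (constPt g').ofConv = (constPt g').ofConv := by
    ext x
    simp [constPt, Algebra.ofId_apply]
  have comp_eq : (leftShiftAlgHom g).comp (leftShiftAlgHom g') = leftShiftAlgHom (g' * g) := by
    calc (leftShiftAlgHom g).comp (leftShiftAlgHom g')
      _ = (toConv ((leftShiftAlgHom g).comp (constPt g').ofConv) *
            toConv (leftShiftAlgHom g)).ofConv := AlgHom.comp_convMul_distrib _ _ _
      _ = (constPt g' * (constPt g * toConv (AlgHom.id k H))).ofConv := by rw [comp_constPt]; rfl
      _ = leftShiftAlgHom (g' * g) := by rw [← mul_assoc, ← constPt_mul]; rfl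
  simpa only [AlgHom.comp_apply, leftShiftAlgHom_apply] using DFunLike.congr_fun comp_eq h

theorem eq_sum_inv_smul_leftShift (g : Pt k H) (r : Repr k h ι) :
    h = ∑ i ∈ r.index, g⁻¹ (r.left i) • leftShift g (r.right i) := by
  simpa [leftShift_eq_sum g⁻¹ r, leftShift_one] using (leftShift_leftShift g g⁻¹ h).symm

theorem algebraMap_apply_eq_sum (g : Pt k H) (r : Repr k h ι) :
    algebraMap k H (g h) =
      ∑ i ∈ r.index, leftShift g (r.left i) * HopfAlgebra.antipode k (r.right i) := by
  have constPt_eq : constPt g = toConv (leftShiftAlgHom g) * (toConv (AlgHom.id k H))⁻¹ := by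
    rw [leftShiftAlgHom, toConv_ofConv, mul_inv_cancel_right]
  have happly := congrArg (fun f : WithConv (H →ₐ[k] H) => f h) constPt_eq
  simp only [convMul_apply_eq_sum _ _ r] at happly
  simp only [← leftShiftAlgHom_apply]
  exact happly

end Shift

section RankOne

open Coalgebra

variable {k H : Type*} [Field k] [CommRing H] [HopfAlgebra k H] {n : ℕ}

theorem isLinearMap_hAct (f : H) : IsLinearMap k (hAct f : EndMap k H n → EndMap k H n) where
  map_add _ _ := funext fun _ => smul_add _ _ _
  map_smul c a := funext fun z => smul_comm (z⁻¹ f) c (a z)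

theorem isLinearMap_cProd (g : Pt k H) (a : EndMap k H n) : IsLinearMap k (cProd g a) where
  map_add _ _ := funext fun _ => mul_add _ _ _
  map_smul c b := funext fun z => mul_smul_comm c (a g) (b (z * g⁻¹))

/-- The conformal endomorphism `z ↦ (p ↦ L_z(v · p) u)` determined by a column `u` and a row `v`:
the analogue of a matrix of rank one. -/
def rankOne : (Fin n → H) →ₗ[k] (Fin n → H) →ₗ[k] EndMap k H n :=
  LinearMap.mk₂ k
    (fun u v z =>
      { toFun p := leftShift z (v ⬝ᵥ p) • u
        map_add' p q := by simp [dotProduct_add, add_smul]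
        map_smul' c p := by simp [dotProduct_smul] })
    (fun u u' v => by ext; simp)
    (fun c u v => by ext; simp)
    (fun u v v' => by ext; simp [add_dotProduct, add_mul])
    (fun c u v => by ext; simp [smul_dotProduct])

@[simp]
theorem rankOne_apply (u v : Fin n → H) (z : Pt k H) (p : Fin n → H) :
    rankOne u v z p = leftShift z (v ⬝ᵥ p) • u := rfl

theorem endMap_ext {a b : EndMap k H n} (h : ∀ z p, a z p = b z p) : a = b :=
  funext fun z => LinearMap.ext (h z)

theorem rankOne_smul_left (h : H) (u v : Fin n → H) :
    (rankOne (h • u) v : EndMap k H n) = h • rankOne u v :=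
  endMap_ext fun z p => smul_comm (leftShift z (v ⬝ᵥ p)) h u

theorem rankOne_smul_left_eq_sum_hAct {h : H} {ι : Type*} (r : Repr k h ι) (u v : Fin n → H) :
    (rankOne (h • u) v : EndMap k H n) =
      ∑ i ∈ r.index, hAct (r.left i) (rankOne u (r.right i • v)) := by
  refine endMap_ext fun z p => ?_
  conv_lhs => rw [rankOne_apply, eq_sum_inv_smul_leftShift z r]
  simp only [hAct, Finset.sum_apply, LinearMap.sum_apply, LinearMap.smul_apply, rankOne_apply,
    smul_dotProduct, smul_eq_mul, leftShift_mul, smul_smul, Finset.sum_smul, Finset.smul_sum]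
  refine Finset.sum_congr rfl fun i _ => ?_
  rw [mul_smul_comm, smul_assoc, mul_comm]

theorem rankOne_smul_right_eq_sum_hAct {h : H} {ι : Type*} (r : Repr k h ι) (u v : Fin n → H) :
    (rankOne u (h • v) : EndMap k H n) =
      ∑ i ∈ r.index, hAct (HopfAlgebra.antipode k (r.left i)) (rankOne (r.right i • u) v) := by
  refine endMap_ext fun z p => ?_
  simp only [hAct, inv_apply_antipode, Finset.sum_apply, LinearMap.sum_apply, LinearMap.smul_apply,
    rankOne_apply, smul_dotProduct, smul_eq_mul, leftShift_mul, leftShift_eq_sum z r,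
    Finset.sum_mul, Finset.sum_smul]
  refine Finset.sum_congr rfl fun i _ => ?_
  rw [smul_mul_assoc, smul_assoc, smul_smul, mul_comm]

theorem hAct_rankOne_eq_sum {h : H} {ι : Type*} (r : Repr k (HopfAlgebra.antipode k h) ι)
    (u v : Fin n → H) :
    hAct h (rankOne u v : EndMap k H n) =
      ∑ i ∈ r.index, rankOne (HopfAlgebra.antipode k (r.right i) • u) (r.left i • v) := by
  refine endMap_ext fun z p => ?_
  rw [hAct, inv_apply, LinearMap.smul_apply, ← algebraMap_smul H, algebraMap_apply_eq_sum z r]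
  simp only [Finset.sum_apply, LinearMap.sum_apply, rankOne_apply, smul_dotProduct, smul_eq_mul,
    leftShift_mul, smul_smul]
  rw [Finset.sum_mul, Finset.sum_smul]
  refine Finset.sum_congr rfl fun i _ => ?_
  rw [mul_right_comm]

theorem cProd_rankOne (g : Pt k H) {a : EndMap k H n} (ha : a ∈ Cend k H n) (u v : Fin n → H) :
    cProd g a (rankOne u v) = rankOne (a g u) v :=
  endMap_ext fun z p => by simp [cProd, ha.2 g, leftShift_leftShift]

theorem rankOne_mem_cend (u v : Fin n → H) : rankOne u v ∈ Cend k H n := by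
  refine ⟨fun p => ⟨((LinearMap.toSpanSingleton H _ u).restrictScalars k).lTensor H
    (comul (v ⬝ᵥ p)), fun z => ?_⟩, fun z f p => ?_⟩
  · rw [evalAt_lTensor]
    rfl
  · rw [rankOne_apply, rankOne_apply, dotProduct_smul, smul_eq_mul, leftShift_mul, mul_smul]

/-- The span of the conformal endomorphisms `rankOne u v` with `v` in a given module of rows. -/
def ofRows (V : Submodule H (Fin n → H)) : Submodule k (EndMap k H n) :=
  Submodule.map₂ rankOne ⊤ (V.restrictScalars k)

theorem ofRows_le {V : Submodule H (Fin n → H)} {B : Submodule k (EndMap k H n)} :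
    ofRows V ≤ B ↔ ∀ u, ∀ v ∈ V, rankOne u v ∈ B := by
  simp [ofRows, Submodule.map₂_le]

theorem rankOne_mem_ofRows {V : Submodule H (Fin n → H)} (u : Fin n → H) {v : Fin n → H}
    (hv : v ∈ V) : rankOne u v ∈ ofRows (k := k) V :=
  ofRows_le.mp le_rfl u v hv

theorem ofRows_mono {V W : Submodule H (Fin n → H)} (h : V ≤ W) :
    ofRows (k := k) V ≤ ofRows W :=
  ofRows_le.mpr fun u _ hv => rankOne_mem_ofRows u (h hv)

theorem smul_mem_ofRows {V : Submodule H (Fin n → H)} (h : H) {b : EndMap k H n}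
    (hb : b ∈ ofRows V) : h • b ∈ ofRows V := by
  suffices ofRows V ≤ (ofRows V).comap (Algebra.lsmul k k (EndMap k H n) h) from this hb
  refine ofRows_le.mpr fun u v hv => ?_
  simpa [← rankOne_smul_left] using rankOne_mem_ofRows (h • u) hv

theorem hAct_mem_ofRows {V : Submodule H (Fin n → H)} (h : H) {b : EndMap k H n}
    (hb : b ∈ ofRows V) : hAct h b ∈ ofRows V := by
  suffices ofRows V ≤ (ofRows V).comap (isLinearMap_hAct h).mk' from this hb
  refine ofRows_le.mpr fun u v hv => ?_
  rw [Submodule.mem_comap, IsLinearMap.mk'_apply, hAct_rankOne_eq_sum (ℛ k _)]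
  exact sum_mem fun i _ => rankOne_mem_ofRows _ (V.smul_mem _ hv)

theorem apply_eq_zero_of_mem_ofRows {V : Submodule H (Fin n → H)} {p : Fin n → H}
    (hp : ∀ v ∈ V, v ⬝ᵥ p = 0) {b : EndMap k H n} (hb : b ∈ ofRows V) (z : Pt k H) :
    b z p = 0 := by
  suffices ofRows V ≤ LinearMap.ker (LinearMap.applyₗ p ∘ₗ LinearMap.proj z) from this hb
  refine ofRows_le.mpr fun u v hv => ?_
  simp [hp v hv]

theorem exists_mem_ofRows_top_apply_eq (v : Fin n → H) (t : H ⊗[k] (Fin n → H)) :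
    ∃ b ∈ ofRows (k := k) ⊤, ∀ z p, b z p = leftShift z (v ⬝ᵥ p) • evalAt z t := by
  induction t with
  | zero => exact ⟨0, zero_mem _, by simp⟩
  | add t t' ht ht' =>
    obtain ⟨b, hb, hbt⟩ := ht
    obtain ⟨b', hb', hbt'⟩ := ht'
    exact ⟨b + b', add_mem hb hb', fun z p => by simp [hbt, hbt']⟩
  | tmul h u =>
    refine ⟨hAct (HopfAlgebra.antipode k h) (rankOne u v),
      hAct_mem_ofRows _ (rankOne_mem_ofRows u trivial), fun z p => ?_⟩
    rw [evalAt_tmul, hAct, inv_apply_antipode, LinearMap.smul_apply, rankOne_apply, smul_comm]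

theorem ofRows_top : ofRows ⊤ = Cend k H n := by
  refine le_antisymm (ofRows_le.mpr fun u v _ => rankOne_mem_cend u v) fun a ha => ?_
  choose t ht using fun j => ha.1 (Pi.single j 1)
  choose b hb hbt using fun j => exists_mem_ofRows_top_apply_eq (Pi.single j 1) (t j)
  have ha_eq : a = ∑ j, b j := endMap_ext fun z p => by
    conv_lhs => rw [pi_eq_sum_univ' p]
    simp [hbt, ← ht, ha.2 z, single_dotProduct]
  exact ha_eq ▸ sum_mem fun j _ => hb j

theorem isLeftIdeal_ofRows (V : Submodule H (Fin n → H)) : IsLeftIdeal (ofRows (k := k) V) where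
  le_cend := (ofRows_mono le_top).trans ofRows_top.le
  hAct_mem f _ hb := hAct_mem_ofRows f hb
  cProd_mem g a ha b hb := by
    suffices ofRows V ≤ (ofRows V).comap (isLinearMap_cProd g a).mk' from this hb
    refine ofRows_le.mpr fun u v hv => ?_
    rw [Submodule.mem_comap, IsLinearMap.mk'_apply, cProd_rankOne g ha]
    exact rankOne_mem_ofRows _ hv

variable (k H n) in
/-- The parametrization `u ⊗ v ↦ rankOne u v` of `Cend_n` by `M_n ⊗ M_n`. The values `a(g)` of
conformal endomorphisms `a` act on the first factor through `b ↦ a ∘_g b`. -/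
def ofRankOne : (Fin n → H) ⊗[k] (Fin n → H) →ₗ[k] EndMap k H n :=
  TensorProduct.lift rankOne

theorem range_ofRankOne : LinearMap.range (ofRankOne k H n) = Cend k H n := by
  rw [← ofRows_top, ofRows, ofRankOne, LinearMap.range_eq_map,
    ← TensorProduct.map₂_mk_top_top_eq_top, Submodule.map_map₂]
  rfl

theorem smul_ofRankOne (h : H) (t : (Fin n → H) ⊗[k] (Fin n → H)) :
    h • ofRankOne k H n t = ofRankOne k H n ((Algebra.lsmul k k _ h).rTensor _ t) := by
  suffices Algebra.lsmul k k (EndMap k H n) h ∘ₗ ofRankOne k H n =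
    ofRankOne k H n ∘ₗ (Algebra.lsmul k k _ h).rTensor _ from LinearMap.congr_fun this t
  refine TensorProduct.ext' fun u v => ?_
  simp [ofRankOne, rankOne_smul_left]

theorem cProd_ofRankOne (g : Pt k H) {a : EndMap k H n} (ha : a ∈ Cend k H n)
    (t : (Fin n → H) ⊗[k] (Fin n → H)) :
    cProd g a (ofRankOne k H n t) = ofRankOne k H n ((a g).rTensor _ t) := by
  suffices (isLinearMap_cProd g a).mk' ∘ₗ ofRankOne k H n =
    ofRankOne k H n ∘ₗ (a g).rTensor _ from LinearMap.congr_fun this t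
  refine TensorProduct.ext' fun u v => ?_
  simp [ofRankOne, cProd_rankOne g ha]

theorem exists_eq_ofRows {B : Submodule k (EndMap k H n)} (hB : B ≤ Cend k H n)
    (hact : ∀ f : H, ∀ b ∈ B, hAct f b ∈ B)
    (htop : leftStabilizer (B.comap (ofRankOne k H n)) = ⊤) :
    ∃ V : Submodule H (Fin n → H), B = ofRows V := by
  let V : Submodule H (Fin n → H) :=
    { rightFactor (B.comap (ofRankOne k H n)) with
      smul_mem' h v hv := mem_rightFactor.mpr fun u => by
        rw [Submodule.mem_comap, ofRankOne, TensorProduct.lift.tmul,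
          rankOne_smul_right_eq_sum_hAct (ℛ k h)]
        exact sum_mem fun i _ => hact _ _ (mem_rightFactor.mp hv _) }
  refine ⟨V, ?_⟩
  calc B = (B.comap (ofRankOne k H n)).map (ofRankOne k H n) := by
        rw [Submodule.map_comap_eq, range_ofRankOne, inf_eq_right.mpr hB]
    _ = ofRows V := by
        rw [← map₂_mk_rightFactor htop, Submodule.map_map₂]
        rfl

end RankOne

section AdjoinH

variable {k H : Type*} [Field k] [CommRing H] [HopfAlgebra k H] {n : ℕ}
  {C B : Submodule k (EndMap k H n)}

theorem adjoinH_le : adjoinH C ≤ B ↔ ∀ h : H, ∀ c ∈ C, h • c ∈ B := by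
  refine Submodule.span_le.trans ⟨fun hB h c hc => hB ⟨h, c, hc, rfl⟩, ?_⟩
  rintro hB _ ⟨h, c, hc, rfl⟩
  exact hB h c hc

theorem smul_mem_adjoinH (h : H) {c : EndMap k H n} (hc : c ∈ C) : h • c ∈ adjoinH C :=
  adjoinH_le.mp le_rfl h c hc

theorem le_adjoinH : C ≤ adjoinH C := fun c hc => by
  simpa using smul_mem_adjoinH (1 : H) hc

theorem adjoinH_le_cend (hC : C ≤ Cend k H n) : adjoinH C ≤ Cend k H n := by
  rw [← ofRows_top] at hC ⊢
  exact adjoinH_le.mpr fun h c hc => smul_mem_ofRows h (hC hc)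

theorem smul_adjoinH_mem (h : H) {b : EndMap k H n} (hb : b ∈ adjoinH C) : h • b ∈ adjoinH C := by
  suffices adjoinH C ≤ (adjoinH C).comap (Algebra.lsmul k k (EndMap k H n) h) from this hb
  refine adjoinH_le.mpr fun h' c hc => ?_
  simpa [smul_smul] using smul_mem_adjoinH (h * h') hc

theorem hAct_mem_adjoinH (hC : ∀ f : H, ∀ c ∈ C, hAct f c ∈ C) (f : H) {b : EndMap k H n}
    (hb : b ∈ adjoinH C) : hAct f b ∈ adjoinH C := by
  suffices adjoinH C ≤ (adjoinH C).comap (isLinearMap_hAct f).mk' from this hb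
  refine adjoinH_le.mpr fun h c hc => ?_
  have hAct_smul : hAct f (h • c) = h • hAct f c := funext fun z => smul_comm (z⁻¹ f) h (c z)
  simpa [hAct_smul] using smul_mem_adjoinH h (hC f c hc)

theorem cProd_mem_adjoinH (hC : IsConformalSubalgebra C) (g : Pt k H) {a b : EndMap k H n}
    (ha : a ∈ C) (hb : b ∈ adjoinH C) : cProd g a b ∈ adjoinH C := by
  suffices adjoinH C ≤ (adjoinH C).comap (isLinearMap_cProd g a).mk' from this hb
  refine adjoinH_le.mpr fun h c hc => ?_
  have cProd_smul : cProd g a (h • c) = leftShift g h • cProd g a c :=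
    endMap_ext fun z p => (hC.le_cend ha).2 g h (c (z * g⁻¹) p)
  simpa [cProd_smul] using smul_mem_adjoinH (leftShift g h) (hC.cProd_mem g a ha c hc)

theorem adjoinH_eq_self (hH : Function.Surjective (algebraMap k H)) : adjoinH C = C := by
  refine le_antisymm (adjoinH_le.mpr fun h c hc => ?_) le_adjoinH
  obtain ⟨x, rfl⟩ := hH h
  simpa using C.smul_mem x hc

end AdjoinH

section Irreducible

variable {k H : Type*} [Field k] [CommRing H] [HopfAlgebra k H] {n : ℕ}
  {C : Submodule k (EndMap k H n)}

theorem nontrivial_of_ne_bot (hne : C ≠ ⊥) : Nontrivial (Fin n → H) := by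
  by_contra htriv
  have := not_nontrivial_iff_subsingleton.mp htriv
  exact hne (Subsingleton.elim _ _)

theorem isSimpleModule_of_isIrreducible (hne : C ≠ ⊥) (hirr : IsIrreducible C)
    {A : Subalgebra k (Module.End k (Fin n → H))} (hH : ∀ h : H, Algebra.lsmul k k _ h ∈ A)
    (hC : ∀ c ∈ C, ∀ g, c g ∈ A) : IsSimpleModule A (Fin n → H) := by
  have := nontrivial_of_ne_bot hne
  have operators_le : operators C ≤ A.toSubmodule := by
    refine Submodule.span_le.mpr ?_
    rintro _ ⟨c, hc, g, rfl⟩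
    exact hC c hc g
  refine { eq_bot_or_eq_top := fun N => ?_ }
  let N' : Submodule H (Fin n → H) :=
    { N with smul_mem' h _ hu := N.smul_mem (⟨_, hH h⟩ : A) hu }
  refine (hirr N' fun α hα u hu => N.smul_mem (⟨α, operators_le hα⟩ : A) hu).imp ?_ ?_
  · exact fun hN => (Submodule.eq_bot_iff N).mpr ((Submodule.eq_bot_iff N').mp hN)
  · exact fun hN => Submodule.eq_top_iff'.mpr fun u => Submodule.eq_top_iff'.mp hN u

theorem lsmul_mem_leftStabilizer (h : H) :
    Algebra.lsmul k k (Fin n → H) h ∈ leftStabilizer ((adjoinH C).comap (ofRankOne k H n)) :=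
  mem_leftStabilizer.mpr fun t ht => by
    rw [Submodule.mem_comap, ← smul_ofRankOne]
    exact smul_adjoinH_mem h ht

theorem apply_mem_leftStabilizer (hC : IsConformalSubalgebra C) {c : EndMap k H n} (hc : c ∈ C)
    (g : Pt k H) : c g ∈ leftStabilizer ((adjoinH C).comap (ofRankOne k H n)) :=
  mem_leftStabilizer.mpr fun t ht => by
    rw [Submodule.mem_comap, ← cProd_ofRankOne g (hC.le_cend hc)]
    exact cProd_mem_adjoinH hC g hc ht

theorem leftStabilizer_eq_top_of_isIrreducible [IsAlgClosed k] (hC : IsConformalSubalgebra C)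
    (hne : C ≠ ⊥) (hirr : IsIrreducible C) :
    leftStabilizer ((adjoinH C).comap (ofRankOne k H n)) = ⊤ := by
  have := isSimpleModule_of_isIrreducible hne hirr (lsmul_mem_leftStabilizer (C := C))
    fun c hc => apply_mem_leftStabilizer hC hc
  have schur := algebraMap_end_bijective_of_forall_exists_smul_eq
    (A := leftStabilizer ((adjoinH C).comap (ofRankOne k H n))) (M := Fin n → H)
    (Bialgebra.counitAlgHom k H) fun h => ⟨⟨_, lsmul_mem_leftStabilizer h⟩, fun _ => rfl⟩
  refine leftStabilizer_eq_top fun α s => ?_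
  obtain ⟨β, hβ⟩ := exists_forall_apply_eq_smul schur.surjective α s
  exact ⟨β, β.2, hβ⟩

theorem exists_adjoinH_eq_ofRows [IsAlgClosed k] (hC : IsConformalSubalgebra C) (hne : C ≠ ⊥)
    (hirr : IsIrreducible C) : ∃ V : Submodule H (Fin n → H), adjoinH C = ofRows V :=
  exists_eq_ofRows (adjoinH_le_cend hC.le_cend) (fun f _ hb => hAct_mem_adjoinH hC.hAct_mem f hb)
    (leftStabilizer_eq_top_of_isIrreducible hC hne hirr)

theorem eq_zero_of_forall_apply_eq_zero (hC : C ≤ Cend k H n) (hne : C ≠ ⊥)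
    (hirr : IsIrreducible C) {p : Fin n → H} (hp : ∀ c ∈ C, ∀ z, c z p = 0) : p = 0 := by
  let N : Submodule H (Fin n → H) :=
    { carrier := {q | ∀ c ∈ C, ∀ z, c z q = 0}
      add_mem' hq hq' c hc z := by rw [map_add, hq c hc, hq' c hc, add_zero]
      zero_mem' c _ z := map_zero _
      smul_mem' h q hq c hc z := by rw [(hC hc).2, hq c hc, smul_zero] }
  have operators_apply_mem : ∀ α ∈ operators C, ∀ q ∈ N, α q ∈ N := fun α hα q hq => by
    suffices operators C ≤ (N.restrictScalars k).comap (LinearMap.applyₗ q) from this hα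
    refine Submodule.span_le.mpr ?_
    rintro _ ⟨c, hc, g, rfl⟩
    have : c g q = 0 := hq c hc g
    simp [this]
  rcases hirr N operators_apply_mem with hN | hN
  · exact (Submodule.eq_bot_iff N).mp hN p hp
  · exact absurd ((Submodule.eq_bot_iff C).mpr fun c hc => endMap_ext fun z q =>
      Submodule.eq_top_iff'.mp hN q c hc z) hne

theorem exists_smul_mem_of_le_ofRows [IsNoetherianRing H] [IsReduced H] (hC : C ≤ Cend k H n)
    (hne : C ≠ ⊥) (hirr : IsIrreducible C) {V : Submodule H (Fin n → H)} (hCV : C ≤ ofRows V)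
    {v : Fin n → H} (hv : v ≠ 0) : ∃ r : H, r • v ∈ V ∧ r • v ≠ 0 :=
  exists_smul_mem_of_forall_dotProduct_eq_zero (IsNoetherian.noetherian V)
    (fun _ hp => eq_zero_of_forall_apply_eq_zero hC hne hirr fun _ hc =>
      apply_eq_zero_of_mem_ofRows hp (hCV hc)) hv

end Irreducible

section RowIdeal

variable {R ι : Type*} [Ring R] [Fintype ι] [DecidableEq ι]

/-- The left ideal of the square matrices all of whose rows lie in a given left submodule. -/
def rowIdeal (V : Submodule R (ι → R)) : Ideal (Matrix ι ι R) where
  carrier := {a | ∀ i, a.row i ∈ V}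
  add_mem' ha hb i := V.add_mem (ha i) (hb i)
  zero_mem' _ := V.zero_mem
  smul_mem' m a ha i := by
    have row_mul : (m • a).row i = ∑ j, m i j • a.row j := by
      ext l
      simp [Matrix.mul_apply]
    rw [row_mul]
    exact sum_mem fun j _ => V.smul_mem _ (ha j)

theorem of_single_mem_rowIdeal {V : Submodule R (ι → R)} (i : ι) {v : ι → R} (hv : v ∈ V) :
    Matrix.of (Pi.single i v) ∈ rowIdeal V := fun j => by
  rw [Matrix.of_row]
  obtain rfl | hj := eq_or_ne j i
  · simpa using hv
  · simp [hj]

theorem isEssential_rowIdeal {V : Submodule R (ι → R)}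
    (hV : ∀ v : ι → R, v ≠ 0 → ∃ r : R, r • v ∈ V ∧ r • v ≠ 0) : IsEssential (rowIdeal V) := by
  intro I hI
  obtain ⟨m, hm, hm0⟩ := Submodule.exists_mem_ne_zero_of_ne_bot hI
  obtain ⟨i, hi⟩ := Function.ne_iff.mp hm0
  obtain ⟨r, hr, hr0⟩ := hV (m.row i) hi
  have single_mul : Matrix.single i i r * m = Matrix.of (Pi.single i (r • m.row i)) := by
    ext j l
    obtain rfl | hj := eq_or_ne j i
    · simp
    · simp [hj, Matrix.single_mul_apply_of_ne]
  refine (Submodule.ne_bot_iff _).mpr ⟨Matrix.of (Pi.single i (r • m.row i)),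
    ⟨of_single_mem_rowIdeal i hr, single_mul ▸ I.mul_mem_left _ hm⟩, fun h0 => hr0 ?_⟩
  exact Pi.single_eq_zero_iff.mp h0

end RowIdeal

section Fourier

open Coalgebra

variable {k H : Type*} [Field k] [CommRing H] [HopfAlgebra k H] {n : ℕ}

theorem evalAt_fourier (z : Pt k H) (h x : H) :
    evalAt z⁻¹ (fourier (k := k) (h ⊗ₜ x)) = z⁻¹ h • leftShift z x := by
  have fourier_eq_sum : fourier (k := k) (h ⊗ₜ x) = ∑ i ∈ (ℛ k x).index,
      (h * HopfAlgebra.antipode k ((ℛ k x).left i)) ⊗ₜ[k] ((ℛ k x).right i) := by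
    simp [fourier, ← (ℛ k x).eq, Finset.mul_sum]
  simp [fourier_eq_sum, leftShift_eq_sum z (ℛ k x), evalAt_tmul, inv_apply_antipode,
    Finset.smul_sum, smul_smul]

theorem ofTensor_fourier (h : H) (a : Matrix (Fin n) (Fin n) H) :
    ofTensor ((fourier (k := k) (H := H)).toLinearMap.mapMatrix (a.map fun x => h ⊗ₜ[k] x)) =
      hAct h (∑ i, rankOne (Pi.single i 1) (a.row i)) := by
  refine endMap_ext fun z p => funext fun i => ?_
  simp [ofTensor, operatorAt, evalAt_fourier, hAct, Finset.sum_apply, Pi.single_apply,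
    dotProduct, Finset.smul_sum, leftShift_mul]

theorem fourierIdeal_le {I : Ideal (Matrix (Fin n) (Fin n) H)} {B : Submodule k (EndMap k H n)} :
    fourierIdeal I ≤ B ↔
      ∀ h : H, ∀ a ∈ I, hAct h (∑ i, rankOne (Pi.single i 1) (a.row i)) ∈ B := by
  simp only [fourierIdeal, tensorIdeal, Submodule.map_span, Submodule.span_le, ← ofTensor_fourier]
  refine ⟨fun hB h a ha => hB ⟨_, ⟨_, ⟨h, a, ha, rfl⟩, rfl⟩, rfl⟩, ?_⟩
  rintro hB _ ⟨_, ⟨_, ⟨h, a, ha, rfl⟩, rfl⟩, rfl⟩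
  exact hB h a ha

theorem fourierIdeal_rowIdeal (V : Submodule H (Fin n → H)) :
    fourierIdeal (k := k) (rowIdeal V) = ofRows V := by
  refine le_antisymm (fourierIdeal_le.mpr fun h a ha =>
    hAct_mem_ofRows h (sum_mem fun i _ => rankOne_mem_ofRows _ (ha i))) ?_
  have hAct_mem (h : H) (i : Fin n) {v : Fin n → H} (hv : v ∈ V) :
      hAct h (rankOne (Pi.single i 1) v) ∈ fourierIdeal (k := k) (rowIdeal V) := by
    have sum_rows : ∑ j, rankOne (Pi.single j 1) ((Matrix.of (Pi.single i v)).row j) =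
        (rankOne (Pi.single i 1) v : EndMap k H n) := by
      rw [Finset.sum_eq_single i (fun j _ hj => by simp [hj]) (by simp)]
      simp
    exact sum_rows ▸ fourierIdeal_le.mp le_rfl h _ (of_single_mem_rowIdeal i hv)
  refine ofRows_le.mpr fun u v hv => ?_
  rw [pi_eq_sum_univ' u, map_sum, LinearMap.sum_apply]
  refine sum_mem fun i _ => ?_
  rw [rankOne_smul_left_eq_sum_hAct (ℛ k (u i))]
  exact sum_mem fun j _ => hAct_mem _ i (V.smul_mem _ hv)

end Fourier

section TrivialGroup

theorem surjective_algebraMap_of_subsingleton {k H : Type*} [Field k] [IsAlgClosed k] [CommRing H]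
    [Algebra k H] [Algebra.FiniteType k H] [IsReduced H] [Subsingleton (H →ₐ[k] k)]
    (ε : H →ₐ[k] k) : Function.Surjective (algebraMap k H) := fun h =>
  ⟨ε h, sub_eq_zero.mp <| eq_zero_of_forall_algHom_apply_eq_zero (k := k) fun g => by
    simp [Subsingleton.elim g ε]⟩

theorem eq_top_of_forall_exists_smul_mem {k H M : Type*} [Field k] [CommRing H] [Algebra k H]
    [AddCommGroup M] [Module H M] (hH : Function.Surjective (algebraMap k H)) {V : Submodule H M}
    (hV : ∀ v : M, v ≠ 0 → ∃ r : H, r • v ∈ V ∧ r • v ≠ 0) : V = ⊤ := by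
  refine Submodule.eq_top_iff'.mpr fun v => ?_
  obtain rfl | hv := eq_or_ne v 0
  · exact V.zero_mem
  obtain ⟨r, hr, hr0⟩ := hV v hv
  obtain ⟨c, rfl⟩ := hH r
  have hc : c ≠ 0 := by
    rintro rfl
    simp at hr0
  exact (V.smul_mem_iff_of_isUnit ((IsUnit.mk0 c hc).map (algebraMap k H))).mp hr

end TrivialGroup

end GConf

end

/-- Let `k` be an algebraically closed field, `G` a linear algebraic group over `k` with coordinate
Hopf algebra `H`, and `C` a nonzero irreducible conformal subalgebra of `Cend_n`. Then
`C_1 = (1 ⊗ H ⊗ E) C` is a left ideal of `Cend_n`, and `C_1 = F(H ⊗ B₀)` for an essential left ideal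
`B₀` of `M_n(H)`. If `G = {e}`, then `C` is the whole of `Cend_n` (Burnside's theorem). -/
theorem mainTheorem1 {k H : Type*} [Field k] [IsAlgClosed k] [CommRing H] [HopfAlgebra k H]
    [Algebra.FiniteType k H] [IsReduced H] (n : ℕ)
    (C : Submodule k (GConf.EndMap k H n)) (hC : GConf.IsConformalSubalgebra C)
    (hne : C ≠ ⊥) (hirr : GConf.IsIrreducible C) :
    GConf.IsLeftIdeal (GConf.adjoinH C) ∧
      (∃ B₀ : Ideal (Matrix (Fin n) (Fin n) H),
        GConf.IsEssential B₀ ∧ GConf.adjoinH C = GConf.fourierIdeal B₀) ∧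
      (Subsingleton (GConf.Pt k H) → C = GConf.Cend k H n) := by
  have : IsNoetherianRing H := Algebra.FiniteType.isNoetherianRing k H
  obtain ⟨V, hV⟩ := GConf.exists_adjoinH_eq_ofRows hC hne hirr
  have hess (v : Fin n → H) (hv : v ≠ 0) : ∃ r : H, r • v ∈ V ∧ r • v ≠ 0 :=
    GConf.exists_smul_mem_of_le_ofRows hC.le_cend hne hirr (hV ▸ GConf.le_adjoinH) hv
  refine ⟨hV ▸ GConf.isLeftIdeal_ofRows V, ⟨GConf.rowIdeal V, GConf.isEssential_rowIdeal hess,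
    hV.trans (GConf.fourierIdeal_rowIdeal V).symm⟩, fun hG => ?_⟩
  have : Subsingleton (H →ₐ[k] k) := (WithConv.equiv (H →ₐ[k] k)).symm.subsingleton
  have hsurj : Function.Surjective (algebraMap k H) :=
    GConf.surjective_algebraMap_of_subsingleton (Bialgebra.counitAlgHom k H)
  calc C = GConf.adjoinH C := (GConf.adjoinH_eq_self hsurj).symm
    _ = GConf.ofRows V := hV
    _ = GConf.ofRows ⊤ := by rw [GConf.eq_top_of_forall_exists_smul_mem hsurj hess]
    _ = GConf.Cend k H n := GConf.ofRows_top
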